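/- An ordered group $(G,P)$ is a (discrete) group $G$ with a submonoid $P$ such that $P\cap P^{-1}=\{1\}$ (a positive cone); $G$ carries the left-invariant partial order $a\le b \iff a^{-1}b\in P$. An order homomorphism $\varphi:(G,P)\to(H,Q)$ is a group homomorphism with $\varphi(P)\subseteq Q$. It is a reduction if for every $p\in P$ it maps the interval $[1,p]$ bijectively onto $[1,\varphi(p)]$, and a strong reduction if it maps $P$ bijectively onto $Q$. We say that $(G,P)$ (strongly) reduces to an amenable ordered group if there are an amenable group $H$, a positive cone $Q\subseteq H$ and a (strong) reduction $(G,P)\to(H,Q)$. Here a discrete group $H$ is amenable if there is a left-invariant mean on $\ell^\infty(H)$ (equivalently, if the canonical map $C^*(H)\to C^*_r(H)$ is injective). A hereditary subgroup of $(G,P)$ is an ordered group $(H,Q)$ with $H$ a subgroup of $G$ and $Q\subseteq P\cap H$ such that $p_1,p_2\in P$, $p_1p_2\in Q$ imply $p_1,p_2\in Q$. For ordered groups $(G_1,P_1),(G_2,P_2)$, let $P_1*P_2\subseteq G_1*G_2$ be the submonoid of the free product generated by the copies of $P_1$ and $P_2$ (similarly for finitely many factors). Let $G_1\wr G_2=\big(\bigoplus_{G_2}G_1\big)\rtimes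 G_2$ be the restricted wreath product, where $G_2$ acts by left translation, and let $P_1\wr P_2$ be its submonoid generated by the copies of $P_1$ (at the coordinate $1$) and $P_2$. Theorem. Each of the two classes of ordered groups, those that reduce to an amenable ordered group and those that strongly reduce to an amenable ordered group, has the following properties. 1. It contains every ordered group $(G,P)$ with $G$ amenable. 2. It is closed under hereditary subgroups. 3. It is closed under finite direct products $(\prod_i G_i,\prod_i P_i)$. 4. It is closed under finite free products $(*_i G_i, *_i P_i)$. In particular, all these products are again ordered groups. Moreover, for all ordered groups $(G_1,P_1)$ and $(G_2,P_2)$, $P_1\wr P_2$ is a positive cone in $G_1\wr G_2$, the natural homomorphism $G_1*G_2\to G_1\wr G_2$ is surjective and is a strong reduction $(G_1*G_2,P_1*P_2)\to(G_1\wr G_2,P_1\wr P_2)$, and $G_1\wr G_2$ is amenable if $G_1$ and $G_2$ are. If $\varphi_i:(G_i,P_i)\to(H_i,Q_i)$ ($i=1,2$) are (strong) reductions of ordered groups, then the composite $G_1*G_2\xrightarrow{\varphi_1*\varphi_2}H_1*H_2\to H_1\wr H_2$ is a (strong) reduction $(G_1*G_2,P_1*P_2)\to(H_1\wr H_2,Q_1\wr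 Q_2)$. -/

import Mathlib

/-! An ordered group `(G, P)` is a group `G` with a positive cone `P`; the order on `G` is the
left-invariant partial order `a ≤ b ↔ a⁻¹ * b ∈ P`. All groups are discrete. -/

universe u

/-- A submonoid `P` of a group is a positive cone if `P ∩ P⁻¹ = {1}`. -/
def IsPositiveCone {G : Type*} [Group G] (P : Submonoid G) : Prop :=
  ∀ x : G, x ∈ P → x⁻¹ ∈ P → x = 1

/-- The relation `a ≤ b` defined by `P`. -/
def ConeLE {G : Type*} [Group G] (P : Submonoid G) (a b : G) : Prop :=
  a⁻¹ * b ∈ P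

/-- The interval `[a, b]` for the order defined by `P`. -/
def coneIcc {G : Type*} [Group G] (P : Submonoid G) (a b : G) : Set G :=
  {g | ConeLE P a g ∧ ConeLE P g b}

/-- A group homomorphism `φ` is an order homomorphism `(G, P) → (H, Q)` if `φ(P) ⊆ Q`. -/
def IsOrderHom {G H : Type*} [Group G] [Group H] (P : Submonoid G) (Q : Submonoid H)
    (φ : G →* H) : Prop :=
  ∀ p ∈ P, φ p ∈ Q

/-- A reduction: an order homomorphism that restricts to a bijection `[1, p] → [1, φ p]` for
every `p ∈ P`. -/
def IsReduction {G H : Type*} [Group G] [Group H] (P : Submonoid G) (Q : Submonoid H)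
    (φ : G →* H) : Prop :=
  IsOrderHom P Q φ ∧ ∀ p ∈ P, Set.BijOn φ (coneIcc P 1 p) (coneIcc Q 1 (φ p))

/-- A strong reduction: an order homomorphism that restricts to a bijection `P → Q`. -/
def IsStrongReduction {G H : Type*} [Group G] [Group H] (P : Submonoid G) (Q : Submonoid H)
    (φ : G →* H) : Prop :=
  IsOrderHom P Q φ ∧ Set.BijOn φ (P : Set G) (Q : Set H)

/-- A (discrete) group is amenable if there is a left-invariant mean on `ℓ^∞(G)`: a positive
linear functional of value `1` at the constant function `1`, invariant under left translation. -/
def IsAmenable (G : Type*) [Group G] : Prop :=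
  ∃ m : lp (fun _ : G => ℝ) ⊤ →ₗ[ℝ] ℝ,
    (∀ f : lp (fun _ : G => ℝ) ⊤, (∀ x, f x = 1) → m f = 1) ∧
    (∀ f : lp (fun _ : G => ℝ) ⊤, (∀ x, 0 ≤ f x) → 0 ≤ m f) ∧
    ∀ (g : G) (f f' : lp (fun _ : G => ℝ) ⊤), (∀ x, f' x = f (g⁻¹ * x)) → m f' = m f

/-- `(G, P)` reduces to an amenable ordered group `(H, Q)`. Taking `H` in the universe of `G` is
no restriction, since `(H, Q)` can be replaced by `(φ(G), φ(P))`. -/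
def ReducesToAmenable {G : Type u} [Group G] (P : Submonoid G) : Prop :=
  ∃ (H : Type u) (_ : Group H) (Q : Submonoid H) (φ : G →* H),
    IsAmenable H ∧ IsPositiveCone Q ∧ IsReduction P Q φ

/-- `(G, P)` strongly reduces to an amenable ordered group `(H, Q)`. -/
def StronglyReducesToAmenable {G : Type u} [Group G] (P : Submonoid G) : Prop :=
  ∃ (H : Type u) (_ : Group H) (Q : Submonoid H) (φ : G →* H),
    IsAmenable H ∧ IsPositiveCone Q ∧ IsStrongReduction P Q φ

/-- `(H, Q)` is a hereditary subgroup of `(G, P)`: `H` is a subgroup of `G`, `Q ⊆ P ∩ H`, and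
`p₁ * p₂ ∈ Q` with `p₁, p₂ ∈ P` implies `p₁, p₂ ∈ Q`. The cone `Q` is given as a submonoid of the
group `H`. -/
def IsHereditarySubgroup {G : Type*} [Group G] (P : Submonoid G) (H : Subgroup G)
    (Q : Submonoid H) : Prop :=
  Q.map H.subtype ≤ P ∧
    ∀ p₁ ∈ P, ∀ p₂ ∈ P, p₁ * p₂ ∈ Q.map H.subtype →
      p₁ ∈ Q.map H.subtype ∧ p₂ ∈ Q.map H.subtype

/-- `P * Q`: the submonoid of the free product `G * H` generated by the copies of `P` and `Q`. -/
def freeProductCone {G H : Type*} [Group G] [Group H] (P : Submonoid G) (Q : Submonoid H) :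
    Submonoid (Monoid.Coprod G H) :=
  P.map Monoid.Coprod.inl ⊔ Q.map Monoid.Coprod.inr

/-- The submonoid of the free product of a family of groups generated by the copies of the
given submonoids. -/
def freeProductConeI {ι : Type*} {G : ι → Type*} [∀ i, Group (G i)]
    (P : ∀ i, Submonoid (G i)) : Submonoid (Monoid.CoprodI G) :=
  ⨆ i, (P i).map Monoid.CoprodI.of

/-- The restricted wreath product `G ≀ H`, as the subgroup of the unrestricted one formed by the
pairs `(f, h)` with `f : H → G` of finite support. The product is
`(f₁, h₁) (f₂, h₂) = (f₁ · f₂(h₁⁻¹ ·), h₁ h₂)`. -/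
def restrictedWreath (G H : Type*) [Group G] [Group H] : Subgroup (RegularWreathProduct G H) where
  carrier := {x | (Function.mulSupport x.left).Finite}
  one_mem' := by simp
  mul_mem' := by
    intro a b ha hb
    have hb' : (Function.mulSupport fun x => b.left (a.right⁻¹ * x)).Finite :=
      Set.Finite.preimage (mul_right_injective (a.right⁻¹)).injOn hb
    exact (Set.Finite.union ha hb').subset (Function.mulSupport_mul _ _)
  inv_mem' := by
    intro a ha
    refine (Set.Finite.preimage (mul_right_injective a.right).injOn ha).subset ?_
    intro x hx
    simpa using hx

open Classical in
/-- The embedding `g ↦ (g δ₁, 1)` of `G` into `G ≀ H`. -/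
noncomputable def wreathLeft (G H : Type*) [Group G] [Group H] : G →* restrictedWreath G H where
  toFun g := ⟨⟨Pi.mulSingle 1 g, 1⟩, by
    refine (Set.finite_singleton (1 : H)).subset ?_
    exact Pi.mulSupport_mulSingle_subset⟩
  map_one' := by
    ext <;> simp
  map_mul' a b := by
    ext <;> simp [Pi.mulSingle_mul]

/-- The embedding `h ↦ (1, h)` of `H` into `G ≀ H`. -/
def wreathRight (G H : Type*) [Group G] [Group H] : H →* restrictedWreath G H where
  toFun h := ⟨⟨1, h⟩, by simp [restrictedWreath]⟩
  map_one' := by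
    ext <;> simp
  map_mul' a b := by
    ext <;> simp

/-- `P ≀ Q`: the submonoid of `G ≀ H` generated by the copies of `P` and `Q`. -/
noncomputable def wreathCone {G H : Type*} [Group G] [Group H]
    (P : Submonoid G) (Q : Submonoid H) : Submonoid (restrictedWreath G H) :=
  P.map (wreathLeft G H) ⊔ Q.map (wreathRight G H)

/-- The natural homomorphism `G * H → G ≀ H`. -/
noncomputable def freeToWreath (G H : Type*) [Group G] [Group H] :
    Monoid.Coprod G H →* restrictedWreath G H :=
  Monoid.Coprod.lift (wreathLeft G H) (wreathRight G H)

/-! The core is a normal form. An element of the cone generated by `P` and `Q` is a product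
x₁y₁x₂y₂⋯ in which only the first and last entries may be 1 (`exists_isReducedPairs`). Already in G
≀ H this expression is unique (`IsReducedPairs.wreath_unique`). The part of the word after y₁ has
its base function supported in y₁Q, so x₁ is the value of the whole base function at 1. Once x₁ is
removed, y₁ is the least point of the support, and the argument repeats. Since normal forms come
from words in G * H, the map to G ≀ H is injective on the cone.

For reductions, `IsReducedPairs.wreath_factor` describes the intervals: a factor a of p in the cone
has as normal form the normal form of p cut inside one pair. Reductions preserve normal forms and
are bijective on the interval below each entry, hence below each word.

Amenability of G ≀ H follows by extension from the finitely supported functions, a directed union of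
finite powers of G. Finite families of free products are reduced to two factors by induction. -/

/-! ### Means and permanence properties of amenability. -/

/-- A finitely additive mean on the bounded real functions on `X`. -/
structure IsMean {X : Type*} (M : (X → ℝ) → ℝ) : Prop where
  add : ∀ f g : X → ℝ, (∃ C, ∀ x, |f x| ≤ C) → (∃ C, ∀ x, |g x| ≤ C) →
    M (fun x => f x + g x) = M f + M g
  smul : ∀ (c : ℝ) (f : X → ℝ), (∃ C, ∀ x, |f x| ≤ C) → M (fun x => c * f x) = c * M f
  one : M (fun _ => 1) = 1
  nonneg : ∀ f : X → ℝ, (∃ C, ∀ x, |f x| ≤ C) → (∀ x, 0 ≤ f x) → 0 ≤ M f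

namespace IsMean

theorem const {X : Type*} {M : (X → ℝ) → ℝ} (hM : IsMean M) (c : ℝ) : M (fun _ => c) = c := by
  have h := hM.smul c (fun _ => 1) ⟨1, by simp⟩
  simpa [hM.one] using h

theorem mono {X : Type*} {M : (X → ℝ) → ℝ} (hM : IsMean M) {f g : X → ℝ}
    (hf : ∃ C, ∀ x, |f x| ≤ C) (hg : ∃ C, ∀ x, |g x| ≤ C) (h : ∀ x, f x ≤ g x) :
    M f ≤ M g := by
  obtain ⟨C, hC⟩ := hf
  obtain ⟨D, hD⟩ := hg
  have hb : ∃ E, ∀ x, |g x - f x| ≤ E :=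
    ⟨D + C, fun x => (abs_sub _ _).trans (add_le_add (hD x) (hC x))⟩
  have h1 := hM.add f (fun x => g x - f x) ⟨C, hC⟩ hb
  have h2 := hM.nonneg (fun x => g x - f x) hb fun x => sub_nonneg.2 (h x)
  have h3 : (fun x => f x + (g x - f x)) = g := by ext x; ring
  rw [h3] at h1
  linarith

theorem abs_apply_le {X : Type*} {M : (X → ℝ) → ℝ} (hM : IsMean M) {f : X → ℝ} {C : ℝ}
    (hf : ∀ x, |f x| ≤ C) : |M f| ≤ C := by
  have h1 := hM.mono ⟨C, hf⟩ ⟨|C|, fun _ => le_rfl⟩ fun x => (abs_le.1 (hf x)).2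
  have h2 := hM.mono ⟨|(-C)|, fun _ => le_rfl⟩ ⟨C, hf⟩ fun x => (abs_le.1 (hf x)).1
  rw [hM.const] at h1 h2
  exact abs_le.2 ⟨h2, h1⟩

theorem map {X Y : Type*} {M : (X → ℝ) → ℝ} (hM : IsMean M) (k : X → Y) :
    IsMean fun f : Y → ℝ => M fun x => f (k x) where
  add _ _ := fun ⟨C, hC⟩ ⟨D, hD⟩ => hM.add _ _ ⟨C, fun _ => hC _⟩ ⟨D, fun _ => hD _⟩
  smul c _ := fun ⟨C, hC⟩ => hM.smul c _ ⟨C, fun _ => hC _⟩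
  one := hM.one
  nonneg _ := fun ⟨C, hC⟩ h => hM.nonneg _ ⟨C, fun _ => hC _⟩ fun _ => h _

theorem bind {X Y : Type*} {M : (X → ℝ) → ℝ} (hM : IsMean M) {N : X → (Y → ℝ) → ℝ}
    (hN : ∀ x, IsMean (N x)) : IsMean fun f : Y → ℝ => M fun x => N x f where
  add f g hf hg := by
    simp only [fun x => (hN x).add f g hf hg]
    obtain ⟨C, hC⟩ := hf
    obtain ⟨D, hD⟩ := hg
    exact hM.add _ _ ⟨C, fun x => (hN x).abs_apply_le hC⟩ ⟨D, fun x => (hN x).abs_apply_le hD⟩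
  smul c f hf := by
    simp only [fun x => (hN x).smul c f hf]
    obtain ⟨C, hC⟩ := hf
    exact hM.smul _ _ ⟨C, fun x => (hN x).abs_apply_le hC⟩
  one := by
    simp only [fun x => (hN x).one]
    exact hM.one
  nonneg f hf h := by
    have h0 := fun x => (hN x).nonneg f hf h
    obtain ⟨C, hC⟩ := hf
    exact hM.nonneg _ ⟨C, fun x => (hN x).abs_apply_le hC⟩ h0

end IsMean

-- The values lie in a compact interval, where every ultrafilter converges, so `limUnder` is a true
-- limit and not its default value.
open Filter Topology in
theorem Ultrafilter.tendsto_limUnder_of_bounded {X : Type*} (U : Ultrafilter X) {f : X → ℝ}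
    (hf : ∃ C, ∀ x, |f x| ≤ C) : Tendsto f U (𝓝 (limUnder (U : Filter X) f)) := by
  obtain ⟨C, hC⟩ := hf
  have hK : IsCompact (Set.Icc (-C) C) := isCompact_Icc
  obtain ⟨x, -, hx⟩ := hK.ultrafilter_le_nhds (U.map f) (by
    rw [Ultrafilter.coe_map, le_principal_iff]
    exact Filter.mem_map.2 (Filter.univ_mem' fun x => abs_le.1 (hC x)))
  exact tendsto_nhds_limUnder ⟨x, hx⟩

open Filter Topology in
theorem Ultrafilter.isMean {X : Type*} (U : Ultrafilter X) :
    IsMean fun f : X → ℝ => limUnder (U : Filter X) f where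
  add _ _ hf hg :=
    ((U.tendsto_limUnder_of_bounded hf).add (U.tendsto_limUnder_of_bounded hg)).limUnder_eq
  smul c _ hf := ((U.tendsto_limUnder_of_bounded hf).const_mul c).limUnder_eq
  one := tendsto_const_nhds.limUnder_eq
  nonneg _ hf h := ge_of_tendsto' (U.tendsto_limUnder_of_bounded hf) h

theorem isAmenable_iff {G : Type*} [Group G] :
    IsAmenable G ↔ ∃ M : (G → ℝ) → ℝ, IsMean M ∧
      ∀ (g : G) (f : G → ℝ), (∃ C, ∀ x, |f x| ≤ C) → M (fun x => f (g * x)) = M f := by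
  classical
  have hmem : ∀ f : G → ℝ, (∃ C, ∀ x, |f x| ≤ C) ↔ Memℓp f ⊤ := by
    intro f
    rw [memℓp_infty_iff]
    constructor
    · rintro ⟨C, hC⟩
      exact ⟨C, by rintro _ ⟨x, rfl⟩; exact hC x⟩
    · rintro ⟨C, hC⟩
      exact ⟨C, fun x => hC ⟨x, rfl⟩⟩
  constructor
  · rintro ⟨m, h1, h0, hinv⟩
    -- The value 0 at unbounded functions is arbitrary: `IsMean` constrains only bounded ones.
    let M : (G → ℝ) → ℝ := fun f => if h : Memℓp f ⊤ then m ⟨f, h⟩ else 0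
    have hM : ∀ (f : G → ℝ) (h : Memℓp f ⊤), M f = m ⟨f, h⟩ := fun f h => dif_pos h
    refine ⟨M, ⟨?_, ?_, ?_, ?_⟩, ?_⟩
    · intro f g hf hg
      rw [hmem] at hf hg
      rw [hM f hf, hM g hg, ← map_add]
      exact hM _ (hf.add hg)
    · intro c f hf
      rw [hmem] at hf
      rw [hM f hf, ← smul_eq_mul, ← map_smul]
      exact hM _ (hf.const_smul c)
    · rw [hM _ ((hmem _).1 ⟨1, by simp⟩)]
      exact h1 _ fun _ => rfl
    · intro f hf h
      rw [hM _ ((hmem _).1 hf)]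
      exact h0 _ h
    · intro g f hf
      have hf' : ∃ C, ∀ x, |f (g * x)| ≤ C := hf.imp fun C hC x => hC _
      rw [hM _ ((hmem _).1 hf), hM _ ((hmem _).1 hf')]
      exact hinv g⁻¹ _ _ fun x => by simp
  · rintro ⟨M, hM, hinv⟩
    have hb : ∀ f : lp (fun _ : G => ℝ) ⊤, ∃ C, ∀ x, |f x| ≤ C := fun f => (hmem _).2 (lp.memℓp f)
    refine ⟨{ toFun := fun f => M f, map_add' := fun f g => hM.add _ _ (hb f) (hb g)
              map_smul' := fun c f => hM.smul c _ (hb f) }, ?_, ?_, ?_⟩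
    · intro f hf
      have : (f : G → ℝ) = fun _ => 1 := funext hf
      exact (congrArg M this).trans hM.one
    · intro f hf
      exact hM.nonneg _ (hb f) hf
    · intro g f f' h
      have : (f' : G → ℝ) = fun x => f (g⁻¹ * x) := funext h
      exact (congrArg M this).trans (hinv g⁻¹ _ (hb f))

namespace IsAmenable

theorem of_surjective {G H : Type*} [Group G] [Group H] (hG : IsAmenable G) (φ : G →* H)
    (hφ : Function.Surjective φ) : IsAmenable H := by
  obtain ⟨M, hM, hinv⟩ := isAmenable_iff.1 hG
  refine isAmenable_iff.2 ⟨_, hM.map φ, fun h f hf => ?_⟩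
  obtain ⟨g, rfl⟩ := hφ h
  simpa using hinv g (fun x => f (φ x)) (hf.imp fun C hC x => hC _)

theorem of_subsingleton {G : Type*} [Group G] [Subsingleton G] : IsAmenable G :=
  isAmenable_iff.2 ⟨fun f => f 1,
    ⟨fun _ _ _ _ => rfl, fun _ _ _ => rfl, rfl, fun _ _ h => h 1⟩,
    fun _ f _ => congrArg f (Subsingleton.elim _ _)⟩

/-- Average over each coset of the image of `N`, then over `Q`. By invariance of `m` the inner
average depends only on the coset, not on the section `s`; left translation by `g` then just moves
the cosets by `π g`. -/
theorem of_extension {N G Q : Type*} [Group N] [Group G] [Group Q] (hN : IsAmenable N)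
    (hQ : IsAmenable Q) (j : N →* G) (π : G →* Q) (hπ : Function.Surjective π)
    (hker : π.ker ≤ j.range) : IsAmenable G := by
  obtain ⟨m, hm, minv⟩ := isAmenable_iff.1 hN
  obtain ⟨M, hM, Minv⟩ := isAmenable_iff.1 hQ
  let s := Function.surjInv hπ
  have hs : ∀ q, π (s q) = q := Function.surjInv_eq hπ
  have hwd : ∀ (f : G → ℝ), (∃ C, ∀ x, |f x| ≤ C) → ∀ g g' : G, π g = π g' →
      m (fun n => f (g * j n)) = m (fun n => f (g' * j n)) := by
    intro f hf g g' h
    obtain ⟨k, hk⟩ := hker (show g⁻¹ * g' ∈ π.ker by simp [MonoidHom.mem_ker, h])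
    have := minv k (fun n => f (g * j n)) (hf.imp fun C hC x => hC _)
    rw [← this]
    simp [hk, ← mul_assoc]
  refine isAmenable_iff.2 ⟨_, hM.bind fun q => hm.map fun n => s q * j n, fun g f hf => ?_⟩
  have hF : ∃ C, ∀ q, |m fun n => f (s q * j n)| ≤ C :=
    hf.imp fun C hC q => hm.abs_apply_le fun n => hC _
  rw [← Minv (π g) _ hF]
  congr 1
  ext q
  simp only [← mul_assoc]
  exact hwd f hf _ _ (by simp [hs])

theorem prod {G H : Type*} [Group G] [Group H] (hG : IsAmenable G) (hH : IsAmenable H) :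
    IsAmenable (G × H) :=
  of_extension hG hH (MonoidHom.inl G H) (MonoidHom.snd G H) Prod.snd_surjective
    fun x hx => ⟨x.1, Prod.ext rfl (MonoidHom.mem_ker.1 hx).symm⟩

theorem pi {ι : Type*} [Finite ι] {G : ι → Type*} [∀ i, Group (G i)]
    (hG : ∀ i, IsAmenable (G i)) : IsAmenable (∀ i, G i) := by
  revert G
  refine Finite.induction_empty_option (P := fun ι => ∀ {G : ι → Type _} [∀ i, Group (G i)],
    (∀ i, IsAmenable (G i)) → IsAmenable (∀ i, G i)) ?_ ?_ ?_ ι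
  · intro α β e h G _ hG
    refine (h fun a => hG (e a)).of_surjective
      { toFun := fun x => Equiv.piCongrLeft G e x, map_one' := ?_, map_mul' := ?_ }
      (Equiv.surjective _)
    · ext b; obtain ⟨a, rfl⟩ := e.surjective b; simp
    · intro x y; ext b; obtain ⟨a, rfl⟩ := e.surjective b; simp
  · intro G _ _
    exact of_subsingleton
  · intro α _ h G _ hG
    refine ((hG none).prod (h fun a => hG (some a))).of_surjective
      { toFun := fun x i => Option.rec x.1 x.2 i, map_one' := ?_, map_mul' := ?_ } ?_
    · ext (_ | a) <;> rfl
    · intro x y; ext (_ | a) <;> rfl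
    · intro x
      exact ⟨(x none, fun a => x (some a)), by ext (_ | a) <;> rfl⟩

-- The mean is the limit, along an ultrafilter finer than `atTop`, of the means pushed forward from
-- the `N i`. A given `g` is eventually in the range of `j i`, so invariance holds eventually and
-- passes to the limit.
open Filter Topology in
theorem of_directed {ι : Type*} [Preorder ι] [Nonempty ι] [IsDirectedOrder ι]
    {N : ι → Type*} [∀ i, Group (N i)] {G : Type*} [Group G] (hN : ∀ i, IsAmenable (N i))
    (j : ∀ i, N i →* G) (hj : ∀ g, ∃ i₀, ∀ i, i₀ ≤ i → g ∈ (j i).range) : IsAmenable G := by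
  choose m hm minv using fun i => isAmenable_iff.1 (hN i)
  let U : Ultrafilter ι := Ultrafilter.of atTop
  have hU : (U : Filter ι) ≤ atTop := Ultrafilter.of_le _
  refine isAmenable_iff.2 ⟨_, U.isMean.bind fun i => (hm i).map (j i), fun g f hf => ?_⟩
  have hF : ∃ C, ∀ i, |m i fun n => f (j i n)| ≤ C :=
    hf.imp fun C hC i => (hm i).abs_apply_le fun n => hC _
  refine ((U.tendsto_limUnder_of_bounded hF).congr' ?_).limUnder_eq
  obtain ⟨i₀, hi₀⟩ := hj g
  filter_upwards [hU (eventually_ge_atTop i₀)] with i hi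
  obtain ⟨k, rfl⟩ := hi₀ i hi
  simpa using (minv i k (fun n => f (j i n)) (hf.imp fun C hC x => hC _)).symm

end IsAmenable

/-! ### Amenability of the restricted wreath product. -/

/-- The projection of the restricted wreath product onto its acting group. -/
def restrictedWreath.rightHom (G H : Type*) [Group G] [Group H] : restrictedWreath G H →* H :=
  RegularWreathProduct.rightHom.comp (restrictedWreath G H).subtype

open Classical in
/-- The functions supported in a finite set `s`, inside the base of the wreath product. -/
noncomputable def restrictedWreath.ofFinset (G : Type*) {H : Type*} [Group G] [Group H]
    (s : Finset H) : (s → G) →* (restrictedWreath.rightHom G H).ker where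
  toFun x := ⟨⟨⟨fun h => if hs : h ∈ s then x ⟨h, hs⟩ else 1, 1⟩,
    s.finite_toSet.subset fun h hh => by by_contra h'; simp_all⟩, rfl⟩
  map_one' := by ext <;> simp
  map_mul' x y := by
    ext h
    · by_cases hs : h ∈ s <;> simp [hs]
    · simp

theorem IsAmenable.restrictedWreath {G H : Type*} [Group G] [Group H] (hG : IsAmenable G)
    (hH : IsAmenable H) : IsAmenable (restrictedWreath G H) := by
  refine IsAmenable.of_extension (N := (restrictedWreath.rightHom G H).ker) ?_ hH
    (Subgroup.subtype _) (restrictedWreath.rightHom G H)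
    (fun h => ⟨wreathRight G H h, rfl⟩) (by simp)
  refine IsAmenable.of_directed (fun s : Finset H => IsAmenable.pi fun _ : s => hG)
    (restrictedWreath.ofFinset G) fun g => ?_
  obtain ⟨⟨⟨f, h⟩, hf⟩, hg⟩ := g
  obtain rfl : h = 1 := hg
  refine ⟨Set.Finite.toFinset hf, fun s hs => ⟨fun x => f x, ?_⟩⟩
  ext x
  · by_cases hx : x ∈ s
    · simp [_root_.restrictedWreath.ofFinset, hx]
    · have : f x = 1 := by
        by_contra h'
        exact hx (hs ((Set.Finite.mem_toFinset hf).2 h'))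
      simp [_root_.restrictedWreath.ofFinset, hx, this]
  · rfl

/-! ### Reduced words in two cones. -/

section Words

variable {A B M : Type*} [Group A] [Group B] [Group M]

theorem mem_coneIcc_one {P : Submonoid A} {g p : A} :
    g ∈ coneIcc P 1 p ↔ g ∈ P ∧ g⁻¹ * p ∈ P := by
  simp [coneIcc, ConeLE]

theorem IsPositiveCone.eq_one_of_mul_eq_one {P : Submonoid A} (hP : IsPositiveCone P) {x y : A}
    (hx : x ∈ P) (hy : y ∈ P) (h : x * y = 1) : x = 1 ∧ y = 1 := by
  have hx1 : x = 1 := hP x hx (by rwa [inv_eq_of_mul_eq_one_right h])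
  exact ⟨hx1, by simpa [hx1] using h⟩

/-- The product `α x₁ * β y₁ * α x₂ * β y₂ * ⋯` of a list of pairs `(xᵢ, yᵢ)`. -/
def evalPairs (α : A →* M) (β : B →* M) (L : List (A × B)) : M :=
  (L.map fun z => α z.1 * β z.2).prod

@[simp]
theorem evalPairs_nil (α : A →* M) (β : B →* M) : evalPairs α β [] = 1 := rfl

@[simp]
theorem evalPairs_cons (α : A →* M) (β : B →* M) (z : A × B) (L : List (A × B)) :
    evalPairs α β (z :: L) = α z.1 * β z.2 * evalPairs α β L := by
  simp [evalPairs]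

@[simp]
theorem evalPairs_append (α : A →* M) (β : B →* M) (L L' : List (A × B)) :
    evalPairs α β (L ++ L') = evalPairs α β L * evalPairs α β L' := by
  simp [evalPairs]

theorem evalPairs_mem (α : A →* M) (β : B →* M) {P : Submonoid A} {Q : Submonoid B}
    {L : List (A × B)} (hL : ∀ z ∈ L, z.1 ∈ P ∧ z.2 ∈ Q) :
    evalPairs α β L ∈ P.map α ⊔ Q.map β := by
  refine Submonoid.list_prod_mem _ fun x hx => ?_
  obtain ⟨z, hz, rfl⟩ := List.mem_map.1 hx
  exact mul_mem (Submonoid.mem_sup_left (Submonoid.mem_map_of_mem _ (hL z hz).1))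
    (Submonoid.mem_sup_right (Submonoid.mem_map_of_mem _ (hL z hz).2))

/-- A nonempty list of pairs with entries in `P` and `Q` is reduced if only its very first and its
very last entry may be `1`. -/
structure IsReducedPairs (P : Submonoid A) (Q : Submonoid B) (L : List (A × B)) : Prop where
  ne_nil : L ≠ []
  mem : ∀ z ∈ L, z.1 ∈ P ∧ z.2 ∈ Q
  chain : L.IsChain fun a b => a.2 ≠ 1 ∧ b.1 ≠ 1

theorem exists_isReducedPairs {P : Submonoid A} {Q : Submonoid B} (hQ : IsPositiveCone Q)
    (α : A →* M) (β : B →* M) {m : M} (hm : m ∈ P.map α ⊔ Q.map β) :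
    ∃ L, IsReducedPairs P Q L ∧ evalPairs α β L = m := by
  rw [Submonoid.sup_eq_closure] at hm
  induction hm using Submonoid.closure_induction_left with
  | one =>
    exact ⟨[(1, 1)], ⟨by simp, by simp [one_mem], by simp⟩, by simp⟩
  | mul_left s hs m _ ih =>
    obtain ⟨L, hL, rfl⟩ := ih
    obtain ⟨hne, hmem, hch⟩ := hL
    obtain - | ⟨⟨x, y⟩, L⟩ := L
    · exact absurd rfl hne
    simp only [List.forall_mem_cons] at hmem
    obtain ⟨⟨hx, hy⟩, hmem⟩ := hmem
    rcases hs with ⟨a, ha, rfl⟩ | ⟨b, hb, rfl⟩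
    · refine ⟨(a * x, y) :: L, ⟨by simp, ?_, ?_⟩, by simp [mul_assoc]⟩
      · simp only [List.forall_mem_cons]
        exact ⟨⟨mul_mem ha hx, hy⟩, hmem⟩
      · rw [List.isChain_cons] at hch ⊢
        exact hch
    · by_cases hb1 : b = 1
      · refine ⟨(x, y) :: L, ⟨by simp, ?_, hch⟩, by simp [hb1]⟩
        simp only [List.forall_mem_cons]
        exact ⟨⟨hx, hy⟩, hmem⟩
      -- A leading 1 may not become an inner entry, so `b` is then absorbed into `y`; positivity
      -- keeps `b * y` nontrivial.
      by_cases hx1 : x = 1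
      · subst hx1
        refine ⟨(1, b * y) :: L, ⟨by simp, ?_, ?_⟩, by simp [mul_assoc]⟩
        · simp only [List.forall_mem_cons]
          exact ⟨⟨hx, mul_mem hb hy⟩, hmem⟩
        · rw [List.isChain_cons] at hch ⊢
          refine ⟨fun z hz => ⟨fun h => ?_, (hch.1 z hz).2⟩, hch.2⟩
          exact hb1 (hQ.eq_one_of_mul_eq_one hb hy h).1
      · refine ⟨(1, b) :: (x, y) :: L, ⟨by simp, ?_, ?_⟩, by simp [mul_assoc]⟩
        · simp only [List.forall_mem_cons]
          exact ⟨⟨one_mem _, hb⟩, ⟨hx, hy⟩, hmem⟩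
        · rw [List.isChain_cons_cons]
          exact ⟨⟨hb1, hx1⟩, hch⟩

/-! ### Uniqueness and factorization of normal forms in the wreath product. -/

section Wreath

variable {P : Submonoid A} {Q : Submonoid B}

theorem evalPairs_wreath_cons_left (z : A × B) (L : List (A × B)) (c : B) :
    (evalPairs (wreathLeft A B) (wreathRight A B) (z :: L)).1.left c =
      (wreathLeft A B z.1).1.left c *
        (evalPairs (wreathLeft A B) (wreathRight A B) L).1.left (z.2⁻¹ * c) := by
  simp [wreathLeft, wreathRight]

/-- Each `A`-letter contributes at the product of the `B`-letters before it, and that product lies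
in `Q`. -/
theorem mem_of_evalPairs_wreath_left_ne_one {L : List (A × B)}
    (hL : ∀ z ∈ L, z.1 ∈ P ∧ z.2 ∈ Q) {c : B}
    (hc : (evalPairs (wreathLeft A B) (wreathRight A B) L).1.left c ≠ 1) : c ∈ Q := by
  induction L generalizing c with
  | nil => simp at hc
  | cons z L ih =>
    rw [List.forall_mem_cons] at hL
    rw [evalPairs_wreath_cons_left] at hc
    by_cases h1 : c = 1
    · exact h1 ▸ one_mem Q
    · have h2 : (wreathLeft A B z.1).1.left c = 1 := by simp [wreathLeft, h1]
      rw [h2, one_mul] at hc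
      simpa using mul_mem hL.1.2 (ih hL.2 hc)

/-- The tail contributes only on `y` times `Q`, which contains 1 only if `y = 1`; in a reduced list
that forces an empty tail, which contributes nothing. -/
theorem evalPairs_wreath_left_one (hQ : IsPositiveCone Q) {x : A} {y : B} {L : List (A × B)}
    (hL : IsReducedPairs P Q ((x, y) :: L)) :
    (evalPairs (wreathLeft A B) (wreathRight A B) ((x, y) :: L)).1.left 1 = x := by
  obtain ⟨-, hmem, hch⟩ := hL
  rw [List.forall_mem_cons] at hmem
  rw [evalPairs_wreath_cons_left]
  have h : (evalPairs (wreathLeft A B) (wreathRight A B) L).1.left (y⁻¹ * 1) = 1 := by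
    by_contra h
    have hy := hQ y hmem.1.2 (by simpa using mem_of_evalPairs_wreath_left_ne_one hmem.2 h)
    obtain - | ⟨z, L⟩ := L
    · simp at h
    · exact (List.isChain_cons_cons.1 hch).1.1 hy
  rw [h]
  simp [wreathLeft]

theorem IsReducedPairs.tail {z w : A × B} {L : List (A × B)}
    (h : IsReducedPairs P Q (z :: w :: L)) : IsReducedPairs P Q (w :: L) :=
  ⟨by simp, (List.forall_mem_cons.1 h.mem).2, (List.isChain_cons_cons.1 h.chain).2⟩

theorem wreathRight_mul_left (y : B) (w : restrictedWreath A B) (c : B) :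
    (wreathRight A B y * w).1.left c = w.1.left (y⁻¹ * c) := by
  simp [wreathRight]

/-- The common base function has the value `x ≠ 1` at `y`, while the right-hand word supports it in
`y'` times `Q`. Used in both directions, this gives `y = y'` by antisymmetry. -/
theorem IsReducedPairs.inv_mul_mem_of_wreath_eq (hQ : IsPositiveCone Q) {x : A} {y y' y₁ : B}
    {L L' : List (A × B)} (hx : x ≠ 1) (hL : IsReducedPairs P Q ((x, y₁) :: L))
    (hL' : ∀ z ∈ L', z.1 ∈ P ∧ z.2 ∈ Q)
    (h : wreathRight A B y * evalPairs (wreathLeft A B) (wreathRight A B) ((x, y₁) :: L) =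
      wreathRight A B y' * evalPairs (wreathLeft A B) (wreathRight A B) L') :
    y'⁻¹ * y ∈ Q := by
  refine mem_of_evalPairs_wreath_left_ne_one hL' ?_
  rw [← wreathRight_mul_left, ← h, wreathRight_mul_left, inv_mul_cancel,
    evalPairs_wreath_left_one hQ hL]
  exact hx

theorem IsReducedPairs.wreath_unique (hQ : IsPositiveCone Q) {L L' : List (A × B)}
    (hL : IsReducedPairs P Q L) (hL' : IsReducedPairs P Q L')
    (h : evalPairs (wreathLeft A B) (wreathRight A B) L =
      evalPairs (wreathLeft A B) (wreathRight A B) L') : L = L' := by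
  induction L generalizing L' with
  | nil => exact absurd rfl hL.ne_nil
  | cons z L ih =>
    obtain - | ⟨⟨x', y'⟩, L'⟩ := L'
    · exact absurd rfl hL'.ne_nil
    obtain ⟨x, y⟩ := z
    obtain rfl : x = x' := by
      rw [← evalPairs_wreath_left_one hQ hL, h, evalPairs_wreath_left_one hQ hL']
    have h' : wreathRight A B y * evalPairs (wreathLeft A B) (wreathRight A B) L =
        wreathRight A B y' * evalPairs (wreathLeft A B) (wreathRight A B) L' := by
      simpa [mul_assoc] using h
    have hm := (List.forall_mem_cons.1 hL.mem)
    have hm' := (List.forall_mem_cons.1 hL'.mem)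
    obtain - | ⟨⟨x₁, y₁⟩, L⟩ := L
    · obtain - | ⟨⟨x₁', y₁'⟩, L'⟩ := L'
      · have : y = y' := by
          have := congrArg (fun w => w.1.right) h'
          simpa [wreathRight] using this
        rw [this]
      -- One tail is empty and has trivial base function, whereas the other takes a nontrivial value
      -- at `y'`.
      · have hc := (List.isChain_cons_cons.1 hL'.chain).1
        have := congrArg (fun w => w.1.left y') h'
        simp only [wreathRight_mul_left, inv_mul_cancel,
          evalPairs_wreath_left_one hQ hL'.tail] at this
        exact absurd this.symm (by simpa using hc.2)
    · have hc := (List.isChain_cons_cons.1 hL.chain).1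
      obtain - | ⟨⟨x₁', y₁'⟩, L'⟩ := L'
      · have := congrArg (fun w => w.1.left y) h'
        simp only [wreathRight_mul_left, inv_mul_cancel,
          evalPairs_wreath_left_one hQ hL.tail] at this
        exact absurd this (by simpa using hc.2)
      · have hc' := (List.isChain_cons_cons.1 hL'.chain).1
        have e1 := hL.tail.inv_mul_mem_of_wreath_eq hQ hc.2 hm'.2 h'
        have e2 := hL'.tail.inv_mul_mem_of_wreath_eq hQ hc'.2 hm.2 h'.symm
        obtain rfl : y' = y := inv_mul_eq_one.1 (hQ _ e1 (by simpa using e2))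
        rw [ih hL.tail hL'.tail (mul_left_cancel h')]

/-- Concatenating two reduced words changes letters only at the seam: `x` merges with `s` if `y =
1`, `y` merges with `t` if `s = 1`, and otherwise nothing merges. Positivity prevents cancellation,
so the result is reduced and equals `L` by uniqueness. The final alternative records that the cut
falls within a single letter of the pair `c`. -/
theorem IsReducedPairs.wreath_factor (hP : IsPositiveCone P) (hQ : IsPositiveCone Q)
    {L K N : List (A × B)} {x : A} {y : B} (hL : IsReducedPairs P Q L)
    (hK : IsReducedPairs P Q (K ++ [(x, y)])) (hN : IsReducedPairs P Q N)
    (h : evalPairs (wreathLeft A B) (wreathRight A B) (K ++ [(x, y)]) *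
        evalPairs (wreathLeft A B) (wreathRight A B) N =
      evalPairs (wreathLeft A B) (wreathRight A B) L) :
    ∃ c C, L = K ++ c :: C ∧ x ∈ coneIcc P 1 c.1 ∧ y ∈ coneIcc Q 1 c.2 ∧
      (y = 1 ∨ x = c.1) := by
  obtain - | ⟨⟨s, t⟩, N⟩ := N
  · exact absurd rfl hN.ne_nil
  simp only [mem_coneIcc_one]
  have hxy := hK.mem (x, y) (by simp)
  have hst := hN.mem (s, t) (by simp)
  have hKm : ∀ z ∈ K, z.1 ∈ P ∧ z.2 ∈ Q := fun z hz => hK.mem z (by simp [hz])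
  have hNm : ∀ z ∈ N, z.1 ∈ P ∧ z.2 ∈ Q := fun z hz => hN.mem z (by simp [hz])
  have hKc := hK.chain
  have hNc := hN.chain
  rw [List.isChain_append] at hKc
  rw [List.isChain_cons] at hNc
  by_cases hy : y = 1
  · refine ⟨(x * s, t), N, ?_, ⟨hxy.1, by simpa using hst.1⟩, by simp [hy, one_mem, hst.2],
      Or.inl hy⟩
    refine hL.wreath_unique hQ ⟨by simp, ?_, ?_⟩ (by simp [← h, hy, mul_assoc])
    · simp only [List.forall_mem_append, List.forall_mem_cons]
      exact ⟨hKm, ⟨mul_mem hxy.1 hst.1, hst.2⟩, hNm⟩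
    · rw [List.isChain_append, List.isChain_cons]
      refine ⟨hKc.1, ⟨hNc.1, hNc.2⟩, fun a ha b hb => ?_⟩
      obtain rfl : (x * s, t) = b := by simpa using hb
      have := hKc.2.2 a ha (x, y) (by simp)
      exact ⟨this.1, fun h1 => this.2 (hP.eq_one_of_mul_eq_one hxy.1 hst.1 h1).1⟩
  by_cases hs : s = 1
  · refine ⟨(x, y * t), N, ?_, ⟨hxy.1, by simp [one_mem]⟩, ⟨hxy.2, by simpa using hst.2⟩,
      Or.inr rfl⟩
    refine hL.wreath_unique hQ ⟨by simp, ?_, ?_⟩ (by simp [← h, hs, mul_assoc])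
    · simp only [List.forall_mem_append, List.forall_mem_cons]
      exact ⟨hKm, ⟨hxy.1, mul_mem hxy.2 hst.2⟩, hNm⟩
    · rw [List.isChain_append, List.isChain_cons]
      refine ⟨hKc.1, ⟨fun b hb => ⟨fun h1 => ?_, (hNc.1 b hb).2⟩, hNc.2⟩, fun a ha b hb => ?_⟩
      · exact hy (hQ.eq_one_of_mul_eq_one hxy.2 hst.2 h1).1
      · obtain rfl : (x, y * t) = b := by simpa using hb
        exact hKc.2.2 a ha (x, y) (by simp)
  · refine ⟨(x, y), (s, t) :: N, ?_, ⟨hxy.1, by simp [one_mem]⟩, ⟨hxy.2, by simp [one_mem]⟩,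
      Or.inr rfl⟩
    refine hL.wreath_unique hQ ⟨by simp, ?_, ?_⟩ (by simp [← h, mul_assoc])
    · simp only [List.forall_mem_append, List.forall_mem_cons]
      exact ⟨hKm, hxy, hst, hNm⟩
    · rw [List.isChain_append_cons_cons, List.isChain_cons]
      exact ⟨hK.chain, ⟨hy, hs⟩, hNc⟩

theorem IsReducedPairs.exists_eq_append {L : List (A × B)} (hL : IsReducedPairs P Q L) :
    ∃ K x y, L = K ++ [(x, y)] := by
  obtain rfl | ⟨K, ⟨x, y⟩, rfl⟩ := List.eq_nil_or_concat' L
  · exact absurd rfl hL.ne_nil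
  · exact ⟨K, x, y, rfl⟩

/-- The equation w w⁻¹ = 1 is a factorization of the reduced word `[(1, 1)]`, so the word of w is a
single pair with entries in the intervals from 1 to 1. -/
theorem isPositiveCone_wreathCone (hP : IsPositiveCone P) (hQ : IsPositiveCone Q) :
    IsPositiveCone (wreathCone P Q) := by
  intro w hw hw'
  obtain ⟨K, hK, rfl⟩ := exists_isReducedPairs hQ _ _ hw
  obtain ⟨N, hN, hNe⟩ := exists_isReducedPairs hQ _ _ hw'
  obtain ⟨K, x, y, rfl⟩ := hK.exists_eq_append
  have h1 : IsReducedPairs P Q [(1, 1)] := ⟨by simp, by simp [one_mem], by simp⟩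
  obtain ⟨c, C, hc, hx, hy, -⟩ := h1.wreath_factor hP hQ hK hN (by rw [hNe, mul_inv_cancel]; simp)
  obtain - | ⟨z, K⟩ := K
  · obtain ⟨rfl, -⟩ : (1, 1) = c ∧ [] = C := by simpa using hc
    rw [mem_coneIcc_one] at hx hy
    simp [hP x hx.1 (by simpa using hx.2), hQ y hy.1 (by simpa using hy.2)]
  · simp at hc

end Wreath

/-! ### Reductions from the free product to the wreath product. -/

section Reductions

variable {C D : Type*} [Group C] [Group D] {P : Submonoid A} {Q : Submonoid B}
  {R : Submonoid C} {S : Submonoid D} {φ : A →* C} {ψ : B →* D}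

theorem IsReducedPairs.map (hφ : IsOrderHom P R φ) (hψ : IsOrderHom Q S ψ)
    (hφ1 : ∀ p ∈ P, φ p = 1 → p = 1) (hψ1 : ∀ p ∈ Q, ψ p = 1 → p = 1) {L : List (A × B)}
    (hL : IsReducedPairs P Q L) : IsReducedPairs R S (L.map (Prod.map φ ψ)) := by
  refine ⟨by simpa using hL.ne_nil, fun z hz => ?_, ?_⟩
  · obtain ⟨w, hw, rfl⟩ := List.mem_map.1 hz
    exact ⟨hφ _ (hL.mem w hw).1, hψ _ (hL.mem w hw).2⟩
  · rw [List.isChain_map]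
    refine hL.chain.imp_of_mem_imp fun a b ha hb h => ?_
    exact ⟨fun h' => h.1 (hψ1 _ (hL.mem a ha).2 h'), fun h' => h.2 (hφ1 _ (hL.mem b hb).1 h')⟩

theorem freeToWreath_comp_map_evalPairs (φ : A →* C) (ψ : B →* D) (L : List (A × B)) :
    ((freeToWreath C D).comp (Monoid.Coprod.map φ ψ))
        (evalPairs Monoid.Coprod.inl Monoid.Coprod.inr L) =
      evalPairs (wreathLeft C D) (wreathRight C D) (L.map (Prod.map φ ψ)) := by
  induction L with
  | nil => simp
  | cons z L ih =>
    simp only [MonoidHom.coe_comp, Function.comp_apply] at ih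
    simp only [MonoidHom.coe_comp, Function.comp_apply, evalPairs_cons, map_mul, ih, List.map_cons]
    simp [freeToWreath]

theorem freeToWreath_comp_map_isOrderHom (hφ : IsOrderHom P R φ) (hψ : IsOrderHom Q S ψ) :
    IsOrderHom (freeProductCone P Q) (wreathCone R S)
      ((freeToWreath C D).comp (Monoid.Coprod.map φ ψ)) := by
  have : freeProductCone P Q ≤
      (wreathCone R S).comap ((freeToWreath C D).comp (Monoid.Coprod.map φ ψ)) := by
    refine sup_le ?_ ?_
    · rintro _ ⟨p, hp, rfl⟩
      exact Submonoid.mem_sup_left ⟨φ p, hφ p hp, by simp [freeToWreath]⟩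
    · rintro _ ⟨p, hp, rfl⟩
      exact Submonoid.mem_sup_right ⟨ψ p, hψ p hp, by simp [freeToWreath]⟩
  exact this

theorem IsReduction.eq_one (h : IsReduction P R φ) {p : A} (hp : p ∈ P) (h1 : φ p = 1) :
    p = 1 :=
  (h.2 p hp).injOn (mem_coneIcc_one.2 ⟨hp, by simp [one_mem]⟩)
    (mem_coneIcc_one.2 ⟨one_mem _, by simpa using hp⟩) (by simpa using h1)

theorem IsReduction.of_injOn_surjOn (h : IsOrderHom P R φ)
    (hinj : ∀ p ∈ P, Set.InjOn φ (coneIcc P 1 p))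
    (hsurj : ∀ p ∈ P, Set.SurjOn φ (coneIcc P 1 p) (coneIcc R 1 (φ p))) : IsReduction P R φ := by
  refine ⟨h, fun p hp => ⟨fun g hg => ?_, hinj p hp, hsurj p hp⟩⟩
  rw [mem_coneIcc_one] at hg ⊢
  exact ⟨h _ hg.1, by simpa using h _ hg.2⟩

/-- A factorization of `φ p` in `R` lifts factor by factor to `P`, and injectivity on `P` identifies
the product of the lifts with `p`. -/
theorem IsStrongReduction.isReduction (h : IsStrongReduction P R φ) : IsReduction P R φ := by
  refine .of_injOn_surjOn h.1 (fun p _ => h.2.injOn.mono fun g hg => (mem_coneIcc_one.1 hg).1)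
    fun p hp q hq => ?_
  rw [mem_coneIcc_one] at hq
  obtain ⟨a, ha, rfl⟩ := h.2.surjOn hq.1
  obtain ⟨b, hb, hb'⟩ := h.2.surjOn hq.2
  have : a * b = p := h.2.injOn (mul_mem ha hb) hp (by simp [hb'])
  exact ⟨a, mem_coneIcc_one.2 ⟨ha, by simpa [← this] using hb⟩, rfl⟩

theorem List.eq_of_map_eq_of_injOn {X Y : Type*} {f : X → Y} {p : X → Prop}
    (hf : ∀ x, p x → ∀ y, p y → f x = f y → x = y) {L L' : List X} (hL : ∀ x ∈ L, p x)
    (hL' : ∀ x ∈ L', p x) (h : L.map f = L'.map f) : L = L' := by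
  induction L generalizing L' with
  | nil => simpa [eq_comm] using h
  | cons x L ih =>
    obtain - | ⟨y, L'⟩ := L'
    · simp at h
    · rw [List.forall_mem_cons] at hL hL'
      simp only [List.map_cons, List.cons.injEq] at h
      rw [hf x hL.1 y hL'.1 h.1, ih hL.2 hL'.2 h.2]

theorem IsStrongReduction.freeToWreath_comp_map (hQ : IsPositiveCone Q)
    (hS : IsPositiveCone S) (hφ : IsStrongReduction P R φ) (hψ : IsStrongReduction Q S ψ) :
    IsStrongReduction (freeProductCone P Q) (wreathCone R S)
      ((freeToWreath C D).comp (Monoid.Coprod.map φ ψ)) := by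
  have hord := freeToWreath_comp_map_isOrderHom hφ.1 hψ.1
  have hmap : ∀ {L}, IsReducedPairs P Q L → IsReducedPairs R S (L.map (Prod.map φ ψ)) :=
    fun hL => hL.map hφ.1 hψ.1 (fun _ hp => hφ.isReduction.eq_one hp)
      (fun _ hp => hψ.isReduction.eq_one hp)
  refine ⟨hord, fun p hp => hord p hp, fun p hp q hq h => ?_, ?_⟩
  · obtain ⟨L, hL, rfl⟩ := exists_isReducedPairs hQ _ _ hp
    obtain ⟨L', hL', rfl⟩ := exists_isReducedPairs hQ _ _ hq
    rw [freeToWreath_comp_map_evalPairs, freeToWreath_comp_map_evalPairs] at h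
    rw [List.eq_of_map_eq_of_injOn ?_ hL.mem hL'.mem ((hmap hL).wreath_unique hS (hmap hL') h)]
    intro z hz w hw hzw
    simp only [Prod.map, Prod.mk.injEq] at hzw
    exact Prod.ext (hφ.2.injOn hz.1 hw.1 hzw.1) (hψ.2.injOn hz.2 hw.2 hzw.2)
  · have : wreathCone R S ≤
        (freeProductCone P Q).map ((freeToWreath C D).comp (Monoid.Coprod.map φ ψ)) := by
      refine sup_le ?_ ?_
      · rintro _ ⟨r, hr, rfl⟩
        obtain ⟨p, hp, rfl⟩ := hφ.2.surjOn hr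
        exact ⟨_, Submonoid.mem_sup_left ⟨p, hp, rfl⟩, by simp [freeToWreath]⟩
      · rintro _ ⟨r, hr, rfl⟩
        obtain ⟨p, hp, rfl⟩ := hψ.2.surjOn hr
        exact ⟨_, Submonoid.mem_sup_right ⟨p, hp, rfl⟩, by simp [freeToWreath]⟩
    exact this

theorem IsReducedPairs.exists_of_mem_coneIcc (hP : IsPositiveCone P) (hQ : IsPositiveCone Q)
    {L : List (A × B)} (hL : IsReducedPairs P Q L) {a : Monoid.Coprod A B}
    (ha : a ∈ coneIcc (freeProductCone P Q) 1 (evalPairs Monoid.Coprod.inl Monoid.Coprod.inr L)) :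
    ∃ K x y c C, L = K ++ c :: C ∧ IsReducedPairs P Q (K ++ [(x, y)]) ∧
      evalPairs Monoid.Coprod.inl Monoid.Coprod.inr (K ++ [(x, y)]) = a ∧
      x ∈ coneIcc P 1 c.1 ∧ y ∈ coneIcc Q 1 c.2 := by
  rw [mem_coneIcc_one] at ha
  obtain ⟨K, hK, rfl⟩ := exists_isReducedPairs hQ _ _ ha.1
  obtain ⟨N, hN, hNe⟩ := exists_isReducedPairs hQ _ _ ha.2
  obtain ⟨K, x, y, rfl⟩ := hK.exists_eq_append
  obtain ⟨c, C, hc, hx, hy, -⟩ := hL.wreath_factor hP hQ hK hN (by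
    -- The factorization is carried to the wreath product of `A` and `B` themselves, where normal
    -- forms are unique.
    have h := freeToWreath_comp_map_evalPairs (MonoidHom.id A) (MonoidHom.id B)
    simp only [MonoidHom.coe_id, Prod.map_id, List.map_id] at h
    rw [← h, ← h, ← h, ← map_mul, hNe, mul_inv_cancel_left])
  exact ⟨K, x, y, c, C, hc, hK, rfl, hx, hy⟩

theorem IsReduction.freeToWreath_comp_map (hP : IsPositiveCone P) (hQ : IsPositiveCone Q)
    (hR : IsPositiveCone R) (hS : IsPositiveCone S) (hφ : IsReduction P R φ)
    (hψ : IsReduction Q S ψ) :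
    IsReduction (freeProductCone P Q) (wreathCone R S)
      ((freeToWreath C D).comp (Monoid.Coprod.map φ ψ)) := by
  have hord := freeToWreath_comp_map_isOrderHom hφ.1 hψ.1
  have hmap : ∀ {L}, IsReducedPairs P Q L → IsReducedPairs R S (L.map (Prod.map φ ψ)) :=
    fun hL => hL.map hφ.1 hψ.1 (fun _ hp => hφ.eq_one hp) (fun _ hp => hψ.eq_one hp)
  refine .of_injOn_surjOn hord (fun p hp a ha b hb hab => ?_) fun p hp w hw => ?_
  · obtain ⟨L, hL, rfl⟩ := exists_isReducedPairs hQ _ _ hp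
    obtain ⟨K, x, y, c, C, hc, hK, rfl, hx, hy⟩ := hL.exists_of_mem_coneIcc hP hQ ha
    obtain ⟨K', x', y', c', C', hc', hK', rfl, hx', hy'⟩ := hL.exists_of_mem_coneIcc hP hQ hb
    rw [freeToWreath_comp_map_evalPairs, freeToWreath_comp_map_evalPairs] at hab
    have h := (hmap hK).wreath_unique hS (hmap hK') hab
    simp only [List.map_append, List.map_cons, List.map_nil] at h
    obtain ⟨h1, h2⟩ := List.append_inj' h rfl
    -- Equal lengths mean that both words cut `L` at the same pair `c`, so injectivity of `φ` and
    -- `ψ` is needed only on the intervals below its entries.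
    have hlen : K.length = K'.length := by simpa using congrArg List.length h1
    obtain ⟨rfl, h3⟩ := List.append_inj (hc.symm.trans hc') hlen
    obtain ⟨rfl, rfl⟩ : c = c' ∧ C = C' := by simpa using h3
    obtain ⟨h4, h5⟩ : φ x = φ x' ∧ ψ y = ψ y' := by simpa using h2
    have hcm := hL.mem c (by simp [hc])
    rw [(hφ.2 _ hcm.1).injOn hx hx' h4, (hψ.2 _ hcm.2).injOn hy hy' h5]
  · obtain ⟨L, hL, rfl⟩ := exists_isReducedPairs hQ _ _ hp
    rw [mem_coneIcc_one] at hw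
    obtain ⟨K, hK, rfl⟩ := exists_isReducedPairs hS _ _ hw.1
    obtain ⟨N, hN, hNe⟩ := exists_isReducedPairs hS _ _ hw.2
    obtain ⟨K, r, s, rfl⟩ := hK.exists_eq_append
    obtain ⟨c, C, hc, hr, hs, hrs⟩ := (hmap hL).wreath_factor hR hS hK hN (by
      rw [hNe, freeToWreath_comp_map_evalPairs, mul_inv_cancel_left])
    obtain ⟨K, C, rfl, rfl, hC⟩ := List.map_eq_append_iff.1 hc
    obtain ⟨⟨p, q⟩, C, rfl, rfl, rfl⟩ := List.map_eq_cons_iff.1 hC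
    have hpq := hL.mem (p, q) (by simp)
    have hKm : ∀ z ∈ K, z.1 ∈ P ∧ z.2 ∈ Q := fun z hz => hL.mem z (by simp [hz])
    have hCm : ∀ z ∈ C, z.1 ∈ P ∧ z.2 ∈ Q := fun z hz => hL.mem z (by simp [hz])
    obtain ⟨x, hx, rfl⟩ := (hφ.2 p hpq.1).surjOn hr
    obtain ⟨y, hy, rfl⟩ := (hψ.2 q hpq.2).surjOn hs
    have hp' : p ∈ coneIcc P 1 p := mem_coneIcc_one.2 ⟨hpq.1, by simp [one_mem]⟩
    -- This makes y⁻¹x⁻¹pq equal to (x⁻¹p)(y⁻¹q), so that the complement of the lifted word lies in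
    -- the cone.
    have hxy : y = 1 ∨ x = p :=
      hrs.imp (hψ.eq_one (mem_coneIcc_one.1 hy).1) ((hφ.2 p hpq.1).injOn hx hp')
    rw [mem_coneIcc_one] at hx hy
    refine ⟨evalPairs Monoid.Coprod.inl Monoid.Coprod.inr (K ++ [(x, y)]),
      mem_coneIcc_one.2 ⟨evalPairs_mem _ _ ?_, ?_⟩, ?_⟩
    · simp only [List.forall_mem_append, List.forall_mem_cons]
      exact ⟨hKm, ⟨hx.1, hy.1⟩, by simp⟩
    · have hmem : evalPairs Monoid.Coprod.inl Monoid.Coprod.inr ((x⁻¹ * p, y⁻¹ * q) :: C) ∈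
          freeProductCone P Q := by
        refine evalPairs_mem _ _ ?_
        rw [List.forall_mem_cons]
        exact ⟨⟨hx.2, hy.2⟩, hCm⟩
      convert hmem using 1
      rcases hxy with rfl | rfl <;> simp [mul_assoc]
    · rw [freeToWreath_comp_map_evalPairs]
      simp

end Reductions
end Words

/-! ### Composition, hereditary subgroups and direct products. -/

section Closure

variable {A B C : Type*} [Group A] [Group B] [Group C] {P : Submonoid A} {Q : Submonoid B}
  {R : Submonoid C}

theorem IsReduction.comp {ψ : B →* C} {φ : A →* B} (hψ : IsReduction Q R ψ)
    (hφ : IsReduction P Q φ) : IsReduction P R (ψ.comp φ) :=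
  ⟨fun p hp => hψ.1 _ (hφ.1 p hp), fun p hp => (hψ.2 _ (hφ.1 p hp)).comp (hφ.2 p hp)⟩

theorem IsStrongReduction.comp {ψ : B →* C} {φ : A →* B} (hψ : IsStrongReduction Q R ψ)
    (hφ : IsStrongReduction P Q φ) : IsStrongReduction P R (ψ.comp φ) :=
  ⟨fun p hp => hψ.1 _ (hφ.1 p hp), hψ.2.comp hφ.2⟩

theorem IsStrongReduction.id (P : Submonoid A) : IsStrongReduction P P (MonoidHom.id A) :=
  ⟨fun _ hp => hp, Set.bijOn_id _⟩

theorem IsStrongReduction.isPositiveCone {φ : A →* B} (hφ : IsStrongReduction P Q φ)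
    (hQ : IsPositiveCone Q) : IsPositiveCone P := fun x hx hx' =>
  hφ.2.injOn hx (one_mem P) <| by
    simpa using hQ _ (hφ.1 _ hx) (by simpa using hφ.1 _ hx')

theorem IsStrongReduction.of_injective {φ : A →* B} (hφ : Function.Injective φ)
    (h : P.map φ = Q) : IsStrongReduction P Q φ := by
  subst h
  exact ⟨fun p hp => ⟨p, hp, rfl⟩, hφ.injOn.bijOn_image⟩

theorem isStrongReduction_freeToWreath (P : Submonoid A) (hQ : IsPositiveCone Q) :
    IsStrongReduction (freeProductCone P Q) (wreathCone P Q) (freeToWreath A B) := by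
  have h := (IsStrongReduction.id P).freeToWreath_comp_map hQ hQ (IsStrongReduction.id Q)
  rwa [Monoid.Coprod.map_id_id, MonoidHom.comp_id] at h

theorem isPositiveCone_freeProductCone (hP : IsPositiveCone P) (hQ : IsPositiveCone Q) :
    IsPositiveCone (freeProductCone P Q) :=
  (isStrongReduction_freeToWreath P hQ).isPositiveCone (isPositiveCone_wreathCone hP hQ)

theorem IsHereditarySubgroup.isPositiveCone {H : Subgroup A} {R : Submonoid H}
    (h : IsHereditarySubgroup P H R) (hP : IsPositiveCone P) : IsPositiveCone R :=
  fun _ hx hx' => Subtype.ext (hP _ (h.1 ⟨_, hx, rfl⟩) (h.1 ⟨_, hx', rfl⟩))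

/-- Heredity puts both factors of any factorization in `P` of an element of the smaller cone back
into that cone, so the intervals coincide. -/
theorem IsHereditarySubgroup.isReduction {H : Subgroup A} {R : Submonoid H}
    (h : IsHereditarySubgroup P H R) : IsReduction R P H.subtype := by
  refine .of_injOn_surjOn (fun q hq => h.1 ⟨q, hq, rfl⟩)
    (fun q _ => H.subtype_injective.injOn) fun q hq g hg => ?_
  rw [mem_coneIcc_one] at hg
  obtain ⟨⟨a, ha, rfl⟩, ⟨b, hb, hb'⟩⟩ := h.2 _ hg.1 _ hg.2 (by simpa using hq)
  refine ⟨a, mem_coneIcc_one.2 ⟨ha, ?_⟩, rfl⟩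
  have : a⁻¹ * q = b := Subtype.ext hb'.symm
  rwa [this]

theorem isPositiveCone_pi {ι : Type*} {G : ι → Type*} [∀ i, Group (G i)]
    {P : ∀ i, Submonoid (G i)} (h : ∀ i, IsPositiveCone (P i)) :
    IsPositiveCone (Submonoid.pi Set.univ P) := fun _ hx hx' =>
  funext fun i => h i _ (hx i trivial) (hx' i trivial)

theorem coneIcc_pi {ι : Type*} {G : ι → Type*} [∀ i, Group (G i)]
    (P : ∀ i, Submonoid (G i)) (p : ∀ i, G i) :
    coneIcc (Submonoid.pi Set.univ P) 1 p = Set.univ.pi fun i => coneIcc (P i) 1 (p i) := by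
  ext g
  simp [mem_coneIcc_one, Submonoid.mem_pi, Set.mem_pi, forall_and]

theorem Set.BijOn.piMap_univ {ι : Type*} {X Y : ι → Type*} {f : ∀ i, X i → Y i}
    {s : ∀ i, Set (X i)} {t : ∀ i, Set (Y i)} (h : ∀ i, Set.BijOn (f i) (s i) (t i)) :
    Set.BijOn (fun x i => f i (x i)) (Set.univ.pi s) (Set.univ.pi t) := by
  refine ⟨fun x hx i hi => (h i).mapsTo (hx i hi), fun x hx y hy hxy => ?_, fun y hy => ?_⟩
  · exact funext fun i => (h i).injOn (hx i trivial) (hy i trivial) (congrFun hxy i)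
  · choose x hx hxy using fun i => (h i).surjOn (hy i trivial)
    exact ⟨x, fun i _ => hx i, funext hxy⟩

theorem IsReduction.piMap {ι : Type*} {G H : ι → Type*} [∀ i, Group (G i)] [∀ i, Group (H i)]
    {P : ∀ i, Submonoid (G i)} {Q : ∀ i, Submonoid (H i)} {φ : ∀ i, G i →* H i}
    (h : ∀ i, IsReduction (P i) (Q i) (φ i)) :
    IsReduction (Submonoid.pi Set.univ P) (Submonoid.pi Set.univ Q) (MonoidHom.piMap φ) := by
  refine ⟨fun p hp i _ => (h i).1 _ (hp i trivial), fun p hp => ?_⟩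
  rw [coneIcc_pi, coneIcc_pi]
  exact Set.BijOn.piMap_univ fun i => (h i).2 _ (hp i trivial)

theorem IsStrongReduction.piMap {ι : Type*} {G H : ι → Type*} [∀ i, Group (G i)]
    [∀ i, Group (H i)] {P : ∀ i, Submonoid (G i)} {Q : ∀ i, Submonoid (H i)}
    {φ : ∀ i, G i →* H i} (h : ∀ i, IsStrongReduction (P i) (Q i) (φ i)) :
    IsStrongReduction (Submonoid.pi Set.univ P) (Submonoid.pi Set.univ Q)
      (MonoidHom.piMap φ) := by
  refine ⟨fun p hp i _ => (h i).1 _ (hp i trivial), ?_⟩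
  rw [Submonoid.coe_pi, Submonoid.coe_pi]
  exact Set.BijOn.piMap_univ fun i => (h i).2

theorem isPositiveCone_prod (hP : IsPositiveCone P) (hQ : IsPositiveCone Q) :
    IsPositiveCone (P.prod Q) := fun _ hx hx' =>
  Prod.ext (hP _ hx.1 hx'.1) (hQ _ hx.2 hx'.2)

theorem coneIcc_prod (P : Submonoid A) (Q : Submonoid B) (p : A × B) :
    coneIcc (P.prod Q) 1 p = coneIcc P 1 p.1 ×ˢ coneIcc Q 1 p.2 := by
  ext g
  simp only [mem_coneIcc_one, Submonoid.mem_prod, Set.mem_prod, Prod.fst_mul, Prod.snd_mul,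
    Prod.fst_inv, Prod.snd_inv]
  tauto

theorem IsReduction.prodMap {D : Type*} [Group D] {S : Submonoid D} {φ : A →* C} {ψ : B →* D}
    (hφ : IsReduction P R φ) (hψ : IsReduction Q S ψ) :
    IsReduction (P.prod Q) (R.prod S) (φ.prodMap ψ) := by
  refine ⟨fun p hp => ⟨hφ.1 _ hp.1, hψ.1 _ hp.2⟩, fun p hp => ?_⟩
  rw [coneIcc_prod, coneIcc_prod]
  exact (hφ.2 _ hp.1).prodMap (hψ.2 _ hp.2)

theorem IsStrongReduction.prodMap {D : Type*} [Group D] {S : Submonoid D} {φ : A →* C}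
    {ψ : B →* D} (hφ : IsStrongReduction P R φ) (hψ : IsStrongReduction Q S ψ) :
    IsStrongReduction (P.prod Q) (R.prod S) (φ.prodMap ψ) :=
  ⟨fun _ hp => ⟨hφ.1 _ hp.1, hψ.1 _ hp.2⟩, hφ.2.prodMap hψ.2⟩

end Closure

/-! ### Free products of families. -/

section Families

open Monoid

/-- The free product of a family over `Option ι` as a binary free product. -/
def Monoid.CoprodI.toCoprodOption {ι : Type*} (G : Option ι → Type*) [∀ i, Group (G i)] :
    CoprodI G →* Coprod (G none) (CoprodI fun i => G (some i)) :=
  CoprodI.lift fun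
    | none => Coprod.inl
    | some i => Coprod.inr.comp (CoprodI.of (M := fun i => G (some i)) (i := i))

/-- The evident map back is a left inverse, and the generating copies of the cones correspond. -/
theorem isStrongReduction_toCoprodOption {ι : Type*} {G : Option ι → Type*} [∀ i, Group (G i)]
    (P : ∀ i, Submonoid (G i)) :
    IsStrongReduction (freeProductConeI P)
      (freeProductCone (P none) (freeProductConeI fun i => P (some i)))
      (CoprodI.toCoprodOption G) := by
  let r : Coprod (G none) (CoprodI fun i => G (some i)) →* CoprodI G :=
    Coprod.lift CoprodI.of (CoprodI.lift fun _ => CoprodI.of)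
  have hr : r.comp (CoprodI.toCoprodOption G) = MonoidHom.id _ := by
    refine CoprodI.ext_hom _ _ fun i => ?_
    ext x
    rcases i with _ | i <;> simp [r, CoprodI.toCoprodOption]
  refine .of_injective (Function.LeftInverse.injective (DFunLike.congr_fun hr)) ?_
  have h0 : (CoprodI.toCoprodOption G).comp (CoprodI.of (i := none)) = Coprod.inl := by
    ext x
    simp [CoprodI.toCoprodOption]
  have h1 : ∀ i, (CoprodI.toCoprodOption G).comp (CoprodI.of (i := some i)) =
      Coprod.inr.comp (CoprodI.of (M := fun i => G (some i)) (i := i)) := by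
    intro i
    ext x
    simp [CoprodI.toCoprodOption]
  rw [freeProductConeI, freeProductCone, freeProductConeI, Submonoid.map_iSup,
    Submonoid.map_iSup, iSup_option]
  simp only [Submonoid.map_map, h0, h1]

/-- Reindexing a free product along an equivalence. -/
def Monoid.CoprodI.reindex {ι κ : Type*} (e : ι ≃ κ) (G : κ → Type*) [∀ i, Group (G i)] :
    CoprodI G →* CoprodI fun i => G (e i) :=
  CoprodI.lift fun k => Eq.rec (motive := fun k _ => G k →* CoprodI fun i => G (e i))
    (CoprodI.of (M := fun i => G (e i)) (i := e.symm k)) (e.apply_symm_apply k)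

theorem Monoid.CoprodI.reindex_comp_of {ι κ : Type*} (e : ι ≃ κ) (G : κ → Type*)
    [∀ i, Group (G i)] (i : ι) :
    (CoprodI.reindex e G).comp (CoprodI.of (i := e i)) =
      CoprodI.of (M := fun i => G (e i)) (i := i) := by
  -- Replacing `e.symm (e i)` by a variable `j` allows the transport to be removed by substitution.
  have h : ∀ (j : ι) (hj : e j = e i),
      (Eq.rec (motive := fun k _ => G k →* CoprodI fun i => G (e i))
        (CoprodI.of (M := fun i => G (e i)) (i := j)) hj : G (e i) →* _) =
      CoprodI.of (M := fun i => G (e i)) (i := i) := by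
    intro j hj
    obtain rfl := e.injective hj
    rfl
  ext x
  simp only [MonoidHom.comp_apply, CoprodI.reindex, CoprodI.lift_of]
  rw [h]

theorem isStrongReduction_reindex {ι κ : Type*} (e : ι ≃ κ) {G : κ → Type*} [∀ i, Group (G i)]
    (P : ∀ i, Submonoid (G i)) :
    IsStrongReduction (freeProductConeI P) (freeProductConeI fun i => P (e i))
      (CoprodI.reindex e G) := by
  let r : (CoprodI fun i => G (e i)) →* CoprodI G := CoprodI.lift fun _ => CoprodI.of
  have hr : r.comp (CoprodI.reindex e G) = MonoidHom.id _ := by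
    refine CoprodI.ext_hom _ _ fun k => ?_
    obtain ⟨i, rfl⟩ := e.surjective k
    rw [MonoidHom.comp_assoc, CoprodI.reindex_comp_of]
    ext x
    simp [r]
  refine .of_injective (Function.LeftInverse.injective (DFunLike.congr_fun hr)) ?_
  simp only [freeProductConeI, Submonoid.map_iSup, Submonoid.map_map]
  rw [← e.iSup_comp]
  simp only [CoprodI.reindex_comp_of]

end Families

/-! ### Closure of the two classes. -/

section Classes

variable {G H : Type u} [Group G] [Group H] {P : Submonoid G} {Q : Submonoid H}

theorem ReducesToAmenable.of_isReduction {φ : G →* H} (hφ : IsReduction P Q φ) :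
    ReducesToAmenable Q → ReducesToAmenable P
  | ⟨K, _, R, ψ, hK, hR, hψ⟩ => ⟨K, _, R, ψ.comp φ, hK, hR, hψ.comp hφ⟩

theorem StronglyReducesToAmenable.of_isStrongReduction {φ : G →* H}
    (hφ : IsStrongReduction P Q φ) :
    StronglyReducesToAmenable Q → StronglyReducesToAmenable P
  | ⟨K, _, R, ψ, hK, hR, hψ⟩ => ⟨K, _, R, ψ.comp φ, hK, hR, hψ.comp hφ⟩

theorem StronglyReducesToAmenable.of_isAmenable (hP : IsPositiveCone P) (hG : IsAmenable G) :
    StronglyReducesToAmenable P :=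
  ⟨G, _, P, MonoidHom.id G, hG, hP, .id P⟩

theorem StronglyReducesToAmenable.reducesToAmenable :
    StronglyReducesToAmenable P → ReducesToAmenable P
  | ⟨K, _, R, ψ, hK, hR, hψ⟩ => ⟨K, _, R, ψ, hK, hR, hψ.isReduction⟩

/-- The inclusion is in general not onto the larger cone, so composing with it does not suffice: the
target cone is shrunk to the image of `R`. -/
theorem IsHereditarySubgroup.stronglyReducesToAmenable {K : Subgroup G} {R : Submonoid K}
    (h : IsHereditarySubgroup P K R) :
    StronglyReducesToAmenable P → StronglyReducesToAmenable R
  | ⟨L, _, S, φ, hL, hS, hφ⟩ => by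
    have hle : ∀ r ∈ R, (r : G) ∈ P := fun r hr => h.1 ⟨r, hr, rfl⟩
    refine ⟨L, _, R.map (φ.comp K.subtype), φ.comp K.subtype, hL, ?_, fun r hr => ⟨r, hr, rfl⟩, ?_⟩
    · rintro _ ⟨r, hr, rfl⟩ ⟨s, hs, hrs⟩
      refine hS _ (hφ.1 _ (hle r hr)) ?_
      rw [← hrs]
      exact hφ.1 _ (hle s hs)
    · exact Set.InjOn.bijOn_image fun r hr s hs hrs =>
        Subtype.ext (hφ.2.injOn (hle r hr) (hle s hs) hrs)

theorem ReducesToAmenable.prod :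
    ReducesToAmenable P → ReducesToAmenable Q → ReducesToAmenable (P.prod Q)
  | ⟨_, _, _, _, hK, hR, hφ⟩, ⟨_, _, _, _, hL, hS, hψ⟩ =>
    ⟨_, _, _, _, hK.prod hL, isPositiveCone_prod hR hS, hφ.prodMap hψ⟩

theorem StronglyReducesToAmenable.prod :
    StronglyReducesToAmenable P → StronglyReducesToAmenable Q →
      StronglyReducesToAmenable (P.prod Q)
  | ⟨_, _, _, _, hK, hR, hφ⟩, ⟨_, _, _, _, hL, hS, hψ⟩ =>
    ⟨_, _, _, _, hK.prod hL, isPositiveCone_prod hR hS, hφ.prodMap hψ⟩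

theorem ReducesToAmenable.pi {ι : Type} [Finite ι] {G : ι → Type u} [∀ i, Group (G i)]
    {P : ∀ i, Submonoid (G i)} (h : ∀ i, ReducesToAmenable (P i)) :
    ReducesToAmenable (Submonoid.pi Set.univ P) := by
  choose K _ R φ hK hR hφ using h
  exact ⟨_, _, _, _, IsAmenable.pi hK, isPositiveCone_pi hR, .piMap hφ⟩

theorem StronglyReducesToAmenable.pi {ι : Type} [Finite ι] {G : ι → Type u} [∀ i, Group (G i)]
    {P : ∀ i, Submonoid (G i)} (h : ∀ i, StronglyReducesToAmenable (P i)) :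
    StronglyReducesToAmenable (Submonoid.pi Set.univ P) := by
  choose K _ R φ hK hR hφ using h
  exact ⟨_, _, _, _, IsAmenable.pi hK, isPositiveCone_pi hR, .piMap hφ⟩

theorem ReducesToAmenable.freeProductCone (hP : IsPositiveCone P) (hQ : IsPositiveCone Q) :
    ReducesToAmenable P → ReducesToAmenable Q → ReducesToAmenable (freeProductCone P Q)
  | ⟨_, _, _, _, hK, hR, hφ⟩, ⟨_, _, _, _, hL, hS, hψ⟩ =>
    ⟨_, _, _, _, hK.restrictedWreath hL, isPositiveCone_wreathCone hR hS,
      hφ.freeToWreath_comp_map hP hQ hR hS hψ⟩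

theorem StronglyReducesToAmenable.freeProductCone (hQ : IsPositiveCone Q) :
    StronglyReducesToAmenable P → StronglyReducesToAmenable Q →
      StronglyReducesToAmenable (freeProductCone P Q)
  | ⟨_, _, _, _, hK, hR, hφ⟩, ⟨_, _, _, _, hL, hS, hψ⟩ =>
    ⟨_, _, _, _, hK.restrictedWreath hL, isPositiveCone_wreathCone hR hS,
      hφ.freeToWreath_comp_map hQ hS hψ⟩

/-- Positivity is part of the induction because the binary step requires it of the remaining free
product. -/
theorem freeProductConeI_closure (ι : Type) [Finite ι] : ∀ (G : ι → Type u) [∀ i, Group (G i)]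
    (P : ∀ i, Submonoid (G i)), (∀ i, IsPositiveCone (P i)) →
      IsPositiveCone (freeProductConeI P) ∧
      ((∀ i, ReducesToAmenable (P i)) → ReducesToAmenable (freeProductConeI P)) ∧
      ((∀ i, StronglyReducesToAmenable (P i)) →
        StronglyReducesToAmenable (freeProductConeI P)) := by
  induction ι using Finite.induction_empty_option with
  | of_equiv e h =>
    intro G _ P hP
    obtain ⟨h1, h2, h3⟩ := h (fun i => G (e i)) (fun i => P (e i)) fun i => hP _
    have hr := isStrongReduction_reindex e P
    exact ⟨hr.isPositiveCone h1, fun h => .of_isReduction hr.isReduction (h2 fun i => h _),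
      fun h => .of_isStrongReduction hr (h3 fun i => h _)⟩
  | h_empty =>
    intro G _ P _
    have : Subsingleton (Monoid.CoprodI G) :=
      ⟨fun x y => by
        have : MonoidHom.id (Monoid.CoprodI G) = 1 := Monoid.CoprodI.ext_hom _ _ nofun
        exact (DFunLike.congr_fun this x).trans (DFunLike.congr_fun this y).symm⟩
    have h1 : IsPositiveCone (freeProductConeI P) := fun _ _ _ => Subsingleton.elim _ _
    have h2 := StronglyReducesToAmenable.of_isAmenable h1 .of_subsingleton
    exact ⟨h1, fun _ => h2.reducesToAmenable, fun _ => h2⟩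
  | h_option h =>
    intro G _ P hP
    obtain ⟨h1, h2, h3⟩ := h (fun i => G (some i)) (fun i => P (some i)) fun i => hP _
    have hr := isStrongReduction_toCoprodOption P
    exact ⟨hr.isPositiveCone (isPositiveCone_freeProductCone (hP _) h1),
      fun h => .of_isReduction hr.isReduction
        (.freeProductCone (hP _) h1 (h none) (h2 fun i => h _)),
      fun h => .of_isStrongReduction hr (.freeProductCone h1 (h none) (h3 fun i => h _))⟩

end Classes

/-! ### Surjectivity onto the wreath product, and the theorem. -/

theorem freeToWreath_surjective (G H : Type*) [Group G] [Group H] :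
    Function.Surjective (freeToWreath G H) := by
  classical
  rw [← MonoidHom.range_eq_top, eq_top_iff]
  have hl : ∀ g, wreathLeft G H g ∈ (freeToWreath G H).range :=
    fun g => ⟨Monoid.Coprod.inl g, by simp [freeToWreath]⟩
  have hr : ∀ h, wreathRight G H h ∈ (freeToWreath G H).range :=
    fun h => ⟨Monoid.Coprod.inr h, by simp [freeToWreath]⟩
  have key : ∀ (s : Finset H) (w : restrictedWreath G H), w.1.right = 1 →
      (∀ h ∉ s, w.1.left h = 1) → w ∈ (freeToWreath G H).range := by
    intro s
    induction s using Finset.induction_on with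
    | empty =>
      intro w hw h
      rw [show w = 1 by ext x <;> simp_all]
      exact one_mem _
    | insert k s _ ih =>
      intro w hw h
      -- Conjugation by `k` moves the coordinate 1 to `k`, so `c` is the part of `w` at `k`;
      -- dividing by it removes `k` from the support.
      let c := wreathRight G H k * wreathLeft G H (w.1.left k) * (wreathRight G H k)⁻¹
      have hc : c ∈ (freeToWreath G H).range := mul_mem (mul_mem (hr _) (hl _)) (inv_mem (hr _))
      have hcl : ∀ x, c.1.left x = if x = k then w.1.left k else 1 := by
        intro x
        simp [c, wreathRight, wreathLeft, Pi.mulSingle_apply, inv_mul_eq_one, eq_comm]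
      have hcr : c.1.right = 1 := by simp [c, wreathRight, wreathLeft]
      rw [← mul_inv_cancel_left c w]
      refine mul_mem hc (ih _ (by simp [hcr, hw]) fun x hx => ?_)
      by_cases hxk : x = k
      · subst hxk
        simp [hcr, hcl]
      · simp [hcr, hcl, hxk, h x (by simp [hxk, hx])]
  intro w _
  rw [← inv_mul_cancel_right w (wreathRight G H w.1.right)]
  refine mul_mem ?_ (hr _)
  have hf : (Function.mulSupport (w * (wreathRight G H w.1.right)⁻¹).1.left).Finite :=
    (w * (wreathRight G H w.1.right)⁻¹).2
  refine key hf.toFinset _ (by simp [wreathRight]) fun h hh => ?_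
  simpa only [Set.Finite.mem_toFinset, Function.mem_mulSupport, not_not] using hh

theorem mainTheorem2 :
    -- amenable ordered groups belong to both classes
    (∀ (G : Type u) [Group G] (P : Submonoid G), IsPositiveCone P → IsAmenable G →
      ReducesToAmenable P ∧ StronglyReducesToAmenable P) ∧
    -- hereditary subgroups
    (∀ (G : Type u) [Group G] (P : Submonoid G) (H : Subgroup G) (Q : Submonoid H),
      IsPositiveCone P → IsHereditarySubgroup P H Q →
        IsPositiveCone Q ∧
        (ReducesToAmenable P → ReducesToAmenable Q) ∧
        (StronglyReducesToAmenable P → StronglyReducesToAmenable Q)) ∧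
    -- direct products of two ordered groups
    (∀ (G₁ G₂ : Type u) [Group G₁] [Group G₂] (P₁ : Submonoid G₁) (P₂ : Submonoid G₂),
      IsPositiveCone P₁ → IsPositiveCone P₂ →
        IsPositiveCone (P₁.prod P₂) ∧
        (ReducesToAmenable P₁ → ReducesToAmenable P₂ → ReducesToAmenable (P₁.prod P₂)) ∧
        (StronglyReducesToAmenable P₁ → StronglyReducesToAmenable P₂ →
          StronglyReducesToAmenable (P₁.prod P₂))) ∧
    -- direct products of finite families
    (∀ (ι : Type) [Finite ι] (G : ι → Type u) [∀ i, Group (G i)] (P : ∀ i, Submonoid (G i)),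
      (∀ i, IsPositiveCone (P i)) →
        IsPositiveCone (Submonoid.pi Set.univ P) ∧
        ((∀ i, ReducesToAmenable (P i)) → ReducesToAmenable (Submonoid.pi Set.univ P)) ∧
        ((∀ i, StronglyReducesToAmenable (P i)) →
          StronglyReducesToAmenable (Submonoid.pi Set.univ P))) ∧
    -- free products of two ordered groups
    (∀ (G₁ G₂ : Type u) [Group G₁] [Group G₂] (P₁ : Submonoid G₁) (P₂ : Submonoid G₂),
      IsPositiveCone P₁ → IsPositiveCone P₂ →
        IsPositiveCone (freeProductCone P₁ P₂) ∧
        (ReducesToAmenable P₁ → ReducesToAmenable P₂ →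
          ReducesToAmenable (freeProductCone P₁ P₂)) ∧
        (StronglyReducesToAmenable P₁ → StronglyReducesToAmenable P₂ →
          StronglyReducesToAmenable (freeProductCone P₁ P₂))) ∧
    -- free products of finite families
    (∀ (ι : Type) [Finite ι] (G : ι → Type u) [∀ i, Group (G i)] (P : ∀ i, Submonoid (G i)),
      (∀ i, IsPositiveCone (P i)) →
        IsPositiveCone (freeProductConeI P) ∧
        ((∀ i, ReducesToAmenable (P i)) → ReducesToAmenable (freeProductConeI P)) ∧
        ((∀ i, StronglyReducesToAmenable (P i)) →
          StronglyReducesToAmenable (freeProductConeI P))) ∧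
    -- the natural map from the free product onto the wreath product is a strong reduction, and
    -- the wreath product of amenable groups is amenable
    (∀ (G₁ G₂ : Type u) [Group G₁] [Group G₂] (P₁ : Submonoid G₁) (P₂ : Submonoid G₂),
      IsPositiveCone P₁ → IsPositiveCone P₂ →
        IsPositiveCone (wreathCone P₁ P₂) ∧
        Function.Surjective (freeToWreath G₁ G₂) ∧
        IsStrongReduction (freeProductCone P₁ P₂) (wreathCone P₁ P₂) (freeToWreath G₁ G₂) ∧
        (IsAmenable G₁ → IsAmenable G₂ → IsAmenable (restrictedWreath G₁ G₂))) ∧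
    -- (strong) reductions of the factors induce one of the free product to the wreath product
    (∀ (G₁ G₂ H₁ H₂ : Type u) [Group G₁] [Group G₂] [Group H₁] [Group H₂]
      (P₁ : Submonoid G₁) (P₂ : Submonoid G₂) (Q₁ : Submonoid H₁) (Q₂ : Submonoid H₂)
      (φ₁ : G₁ →* H₁) (φ₂ : G₂ →* H₂),
      IsPositiveCone P₁ → IsPositiveCone P₂ → IsPositiveCone Q₁ → IsPositiveCone Q₂ →
        (IsReduction P₁ Q₁ φ₁ → IsReduction P₂ Q₂ φ₂ →
          IsReduction (freeProductCone P₁ P₂) (wreathCone Q₁ Q₂)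
            ((freeToWreath H₁ H₂).comp (Monoid.Coprod.map φ₁ φ₂))) ∧
        (IsStrongReduction P₁ Q₁ φ₁ → IsStrongReduction P₂ Q₂ φ₂ →
          IsStrongReduction (freeProductCone P₁ P₂) (wreathCone Q₁ Q₂)
            ((freeToWreath H₁ H₂).comp (Monoid.Coprod.map φ₁ φ₂)))) := by
  refine ⟨fun G _ P hP hG => ?_, fun G _ P H Q hP hQ => ?_, fun G₁ G₂ _ _ P₁ P₂ h₁ h₂ => ?_,
    fun ι _ G _ P hP => ?_, fun G₁ G₂ _ _ P₁ P₂ h₁ h₂ => ?_, fun ι _ G _ P hP => ?_,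
    fun G₁ G₂ _ _ P₁ P₂ h₁ h₂ => ?_,
    fun G₁ G₂ H₁ H₂ _ _ _ _ P₁ P₂ Q₁ Q₂ φ₁ φ₂ h₁ h₂ h₃ h₄ => ?_⟩
  · have h := StronglyReducesToAmenable.of_isAmenable hP hG
    exact ⟨h.reducesToAmenable, h⟩
  · exact ⟨hQ.isPositiveCone hP, .of_isReduction hQ.isReduction, hQ.stronglyReducesToAmenable⟩
  · exact ⟨isPositiveCone_prod h₁ h₂, .prod, .prod⟩
  · exact ⟨isPositiveCone_pi hP, .pi, .pi⟩
  · exact ⟨isPositiveCone_freeProductCone h₁ h₂, .freeProductCone h₁ h₂, .freeProductCone h₂⟩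
  · exact freeProductConeI_closure ι G P hP
  · exact ⟨isPositiveCone_wreathCone h₁ h₂, freeToWreath_surjective G₁ G₂,
      isStrongReduction_freeToWreath P₁ h₂, .restrictedWreath⟩
  · exact ⟨fun hφ hψ => hφ.freeToWreath_comp_map h₁ h₂ h₃ h₄ hψ,
      fun hφ hψ => hφ.freeToWreath_comp_map h₂ h₄ hψ⟩
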